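/- Let $M$ be a connected, paracompact (Hausdorff) smooth manifold of dimension $m$, let $\mathfrak{X}(M)$ be the $C^\infty(M)$-module of smooth vector fields on $M$, identified with the derivations of $C^\infty(M)$, and let $\mathcal{D}(M)$ be the $C^\infty(M)$-module and real Lie algebra (under the commutator) of differential operators of order $\le 1$ on $C^\infty(M)$. A symplectic Lie–Rinehart–Jacobi algebra structure on $\mathcal{D}(M)$ is a pair $(\rho,\omega)$ in which: - $\rho:\mathcal{D}(M)\to\mathcal{D}(M)$ is a morphism both of $C^\infty(M)$-modules and of real Lie algebras, with $[\varphi,f\psi]=\big(\rho(\varphi)(f)-f\,\rho(\varphi)(1)\big)\psi+f[\varphi,\psi]$ for all $f\in C^\infty(M)$ and $\varphi,\psi\in\mathcal{D}(M)$; - $\omega:\mathcal{D}(M)\times\mathcal{D}(M)\to C^\infty(M)$ is a skew-symmetric $C^\infty(M)$-bilinear form which is nondegenerate, i.e. $\varphi\mapsto\omega(\varphi,\cdot)$ is an isomorphism from $\mathcal{D}(M)$ onto its $C^\infty(M)$-dual, and which satisfies $d_\rho\omega=0$, i.e. for all $\varphi,\psi,\eta\in\mathcal{D}(M)$ $$\rho(\varphi)(\omega(\psi,\eta))-\rho(\psi)(\omega(\varphi,\eta))+\rho(\eta)(\omega(\varphi,\psi))-\omega([\varphi,\psi],\eta)+\omega([\varphi,\eta],\psi)-\omega([\psi,\eta],\varphi)=0.$$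 If $\mathcal{D}(M)$ admits a symplectic Lie–Rinehart–Jacobi algebra structure, then $M$ is a nonexact (that is, not necessarily exact) contact manifold in the sense of Lichnerowicz: the dimension of $M$ is odd, $m=2n+1$, and there exist a differential $1$-form $\beta:\mathfrak{X}(M)\to C^\infty(M)$ and a skew-symmetric differential $2$-form $\Omega:\mathfrak{X}(M)\times\mathfrak{X}(M)\to C^\infty(M)$ such that $\beta\wedge\Omega^n$ is a volume form on $M$ (it vanishes at no point of $M$). -/

import Mathlib

open scoped Manifold ContDiff

section LieRinehart

attribute [local instance 100] LieRing.ofAssociativeRing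

/-- The `K`-Lie algebra `Diff_K(A)` of differential operators of order `≤ 1` on the commutative
`K`-algebra `A`: the `K`-linear maps `P : A → A` such that `[[P, f], g] = 0` for all `f g : A`,
where elements of `A` act by multiplication. The bracket is the commutator. -/
def DiffOp (K A : Type*) [Field K] [CommRing A] [Algebra K A] :
    LieSubalgebra K (Module.End K A) where
  carrier := {P | ∀ f g : A, ⁅⁅P, LinearMap.mulLeft K f⁆, LinearMap.mulLeft K g⁆ = 0}
  zero_mem' := by intro f g; simp
  add_mem' := by
    intro P Q hP hQ f g
    have h1 := hP f g
    have h2 := hQ f g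
    simp only [add_lie, h1, h2, add_zero]
  smul_mem' := by
    intro c P hP f g
    have h1 := hP f g
    simp only [smul_lie, h1, smul_zero]
  lie_mem' := by
    intro P Q hP hQ f g
    have key : ∀ R : Module.End K A,
        (∀ f g : A, ⁅⁅R, LinearMap.mulLeft K f⁆, LinearMap.mulLeft K g⁆ = 0) →
        ∀ f : A, ⁅R, LinearMap.mulLeft K f⁆ =
          LinearMap.mulLeft K (⁅R, LinearMap.mulLeft K f⁆ 1) := by
      intro R hR f
      ext h
      have h2 := LinearMap.congr_fun (hR f h) 1
      rw [Ring.lie_def] at h2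
      simp only [LinearMap.sub_apply, Module.End.mul_apply, LinearMap.mulLeft_apply, mul_one,
        LinearMap.zero_apply] at h2
      rw [sub_eq_zero] at h2
      rw [h2, LinearMap.mulLeft_apply, mul_comm]
    rw [lie_lie P Q, key Q hQ f, key P hP f, sub_lie, hP, hQ, sub_zero]

section ModuleStructure

variable {K A : Type*} [Field K] [CommRing A] [Algebra K A]

instance : SMul A (DiffOp K A) where
  smul a P := ⟨a • (P : Module.End K A), by
    intro f g
    have h : ∀ (R : Module.End K A) (h : A),
        ⁅a • R, LinearMap.mulLeft K h⁆ = a • ⁅R, LinearMap.mulLeft K h⁆ := by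
      intro R h
      ext k
      simp only [Ring.lie_def, LinearMap.sub_apply, Module.End.mul_apply, LinearMap.smul_apply,
        LinearMap.mulLeft_apply, smul_eq_mul]
      ring
    rw [h, h, P.2 f g, smul_zero]⟩

/-- The `A`-module structure on `Diff_K(A)`: `(a • P) f = a * P f`. -/
instance : Module A (DiffOp K A) :=
  Function.Injective.module A
    (⟨⟨Subtype.val, rfl⟩, fun _ _ => rfl⟩ : DiffOp K A →+ Module.End K A)
    Subtype.val_injective (fun _ _ => rfl)

instance : IsScalarTower K A (DiffOp K A) where
  smul_assoc c a P := Subtype.ext (smul_assoc c a (P : Module.End K A))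

end ModuleStructure

/-- A Lie–Rinehart algebra structure on `G`, which is at the same time an `A`-module and a
`K`-Lie algebra: a morphism `ρ : G → Diff_K(A)` of `A`-modules and of `K`-Lie algebras with
`[x, a • y] = (ρ(x)(a) - a ρ(x)(1)) • y + a • [x, y]`. -/
structure LieRinehartStructure (K A G : Type*) [Field K] [CommRing A] [Algebra K A]
    [LieRing G] [LieAlgebra K G] [Module A G] [IsScalarTower K A G] where
  ρ : G →ₗ[A] DiffOp K A
  map_lie : ∀ x y : G, ρ ⁅x, y⁆ = ⁅ρ x, ρ y⁆
  lie_smul : ∀ (a : A) (x y : G),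
    ⁅x, a • y⁆ = ((ρ x).1 a - a * (ρ x).1 1) • y + a • ⁅x, y⁆

/-- The cohomology operator `d_ρ` of a Lie–Rinehart algebra, on bilinear forms. -/
def LieRinehartStructure.d₂ {K A G : Type*} [Field K] [CommRing A] [Algebra K A]
    [LieRing G] [LieAlgebra K G] [Module A G] [IsScalarTower K A G]
    (S : LieRinehartStructure K A G) (μ : G →ₗ[A] G →ₗ[A] A) (x y z : G) : A :=
  (S.ρ x).1 (μ y z) - (S.ρ y).1 (μ x z) + (S.ρ z).1 (μ x y)
    - μ ⁅x, y⁆ z + μ ⁅x, z⁆ y - μ ⁅y, z⁆ x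

/-- A symplectic Lie–Rinehart–Jacobi algebra structure on `G`: a Lie–Rinehart algebra structure
with a skew-symmetric `A`-bilinear form `μ` such that `d_ρ μ = 0` and such that
`x ↦ i_x μ` is an isomorphism from `G` onto its `A`-dual. -/
structure SymplecticLieRinehartJacobi (K A G : Type*) [Field K] [CommRing A] [Algebra K A]
    [LieRing G] [LieAlgebra K G] [Module A G] [IsScalarTower K A G]
    extends LieRinehartStructure K A G where
  μ : G →ₗ[A] G →ₗ[A] A
  skew : ∀ x y : G, μ x y = -μ y x
  closed : ∀ x y z : G, toLieRinehartStructure.d₂ μ x y z = 0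
  nondegenerate : Function.Bijective (fun x : G => (μ x : Module.Dual A G))

end LieRinehart

section Manifold

/-- The algebra `C^∞(M)` of smooth real functions on an `m`-dimensional manifold `M`. -/
abbrev SmoothFn (m : ℕ) (M : Type*) [TopologicalSpace M]
    [ChartedSpace (EuclideanSpace ℝ (Fin m)) M] : Type _ :=
  C^∞⟮𝓡 m, M; 𝓘(ℝ, ℝ), ℝ⟯

/-- The `C^∞(M)`-module `𝔛(M)` of smooth vector fields on `M`, as derivations of `C^∞(M)`. -/
abbrev VecField (m : ℕ) (M : Type*) [TopologicalSpace M]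
    [ChartedSpace (EuclideanSpace ℝ (Fin m)) M] : Type _ :=
  Derivation ℝ (SmoothFn m M) (SmoothFn m M)

/-- The `C^∞(M)`-module and Lie algebra `𝒟(M)` of differential operators of order `≤ 1`
on `C^∞(M)`. -/
abbrev DiffOpManifold (m : ℕ) (M : Type*) [TopologicalSpace M]
    [ChartedSpace (EuclideanSpace ℝ (Fin m)) M] : Type _ :=
  DiffOp ℝ (SmoothFn m M)

/-- The exterior product `β ∧ Ω ∧ ⋯ ∧ Ω` (`n` factors `Ω`) of a `1`-form and a skew-symmetric
`2`-form, evaluated on `2n+1` vector fields. The factor `2⁻ⁿ` is the one of the convention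
`(α ∧ β)(X, Y) = α(X) β(Y) - α(Y) β(X)`, in which products are sums over shuffles. -/
noncomputable def wedgePow {m : ℕ} {M : Type*} [TopologicalSpace M]
    [ChartedSpace (EuclideanSpace ℝ (Fin m)) M]
    (β : VecField m M →ₗ[SmoothFn m M] SmoothFn m M)
    (Ω : VecField m M →ₗ[SmoothFn m M] VecField m M →ₗ[SmoothFn m M] SmoothFn m M)
    (n : ℕ) (X : Fin (2 * n + 1) → VecField m M) : SmoothFn m M :=
  ((2 : ℝ) ^ n)⁻¹ • ∑ σ : Equiv.Perm (Fin (2 * n + 1)),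
    ((Equiv.Perm.sign σ : ℤ) : ℝ) • (β (X (σ 0)) *
      ∏ i : Fin n, Ω (X (σ ⟨2 * i + 1, by omega⟩)) (X (σ ⟨2 * i + 2, by omega⟩)))

/-- `M` is a nonexact (i.e. not necessarily exact) contact manifold: its dimension is odd,
`m = 2n+1`, and there are a `1`-form `β` and a skew-symmetric `2`-form `Ω` on `M` such that
`β ∧ Ωⁿ` is a volume form, i.e. vanishes at no point. (The exact case is `Ω = dβ`.) -/
def IsNonexactContactManifold (m : ℕ) (M : Type*) [TopologicalSpace M]
    [ChartedSpace (EuclideanSpace ℝ (Fin m)) M] : Prop :=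
  ∃ n : ℕ, m = 2 * n + 1 ∧
    ∃ (β : VecField m M →ₗ[SmoothFn m M] SmoothFn m M)
      (Ω : VecField m M →ₗ[SmoothFn m M] VecField m M →ₗ[SmoothFn m M] SmoothFn m M),
      (∀ X Y : VecField m M, Ω X Y = -Ω Y X) ∧
      ∀ p : M, ∃ X : Fin (2 * n + 1) → VecField m M, wedgePow β Ω n X p ≠ 0

end Manifold

/-! An operator of order at most one splits as a function times the identity plus a derivation, so
𝒟(M) has fibres of dimension m + 1 and `DiffOp.id` is a nowhere vanishing section. The forms are β =
μ(id, ·) and Ω = μ, both restricted to vector fields. Nondegeneracy makes every fibre a symplectic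
vector space, hence m + 1 = 2(n + 1).

In a fibre, complete v = id to a symplectic basis with e₀ = v and push the other vectors into the
derivations along v. Then β is 1 on f₀ and 0 on the remaining eᵢ, fᵢ, on which Ω is standard; so β ∧
Ωⁿ is positive on this basis (`exists_sum_sign_mul_pairs_pos`).

The passage from modules to fibres rests on local frames for derivations of C^∞(M), obtained from
Hadamard's lemma (`exists_local_frame`). They turn the isomorphism with the module dual into
invertibility of a Gram matrix at each point (`exists_local_frame_gram_mul_eq_one`). -/

/-! ### Symplectic linear algebra -/

/-- Induction on the dimension: split off the hyperbolic plane spanned by `v` and a dual vector,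
then pass to its orthogonal complement, on which the form stays nondegenerate. -/
theorem exists_symplectic_basis {V : Type*} [AddCommGroup V] [Module ℝ V] [FiniteDimensional ℝ V]
    (B : V →ₗ[ℝ] V →ₗ[ℝ] ℝ) (hB : ∀ v w, B v w = -B w v) (hnd : ∀ v, (∀ w, B v w = 0) → v = 0)
    (v : V) (hv : v ≠ 0) :
    ∃ (n : ℕ) (e f : Fin (n + 1) → V), Module.finrank ℝ V = 2 * (n + 1) ∧ e 0 = v ∧
      (∀ i j, B (e i) (e j) = 0) ∧ (∀ i j, B (f i) (f j) = 0) ∧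
      ∀ i j, B (e i) (f j) = if i = j then 1 else 0 := by
  induction hd : Module.finrank ℝ V using Nat.strong_induction_on generalizing V with
  | _ d ih =>
  have hself : ∀ u, B u u = 0 := fun u => by linarith [hB u u]
  obtain ⟨f₀, hf₀⟩ : ∃ f, B v f = 1 := by
    obtain ⟨w, hw⟩ : ∃ w, B v w ≠ 0 := by
      by_contra! h
      exact hv (hnd v h)
    exact ⟨(B v w)⁻¹ • w, by simp [hw]⟩
  have hf₀' : B f₀ v = -1 := by rw [hB, hf₀]
  let φ : V →ₗ[ℝ] ℝ × ℝ := (B v).prod (B f₀)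
  have hφ : Function.Surjective φ := fun ⟨a, b⟩ =>
    ⟨a • f₀ - b • v, by simp [φ, hf₀, hf₀', hself]⟩
  let W := LinearMap.ker φ
  have hrank : Module.finrank ℝ V = 2 + Module.finrank ℝ W := by
    rw [← LinearMap.finrank_range_add_finrank_ker φ, LinearMap.range_eq_top.2 hφ, finrank_top]
    simp [W]
  have hW : ∀ w : W, B v w = 0 ∧ B f₀ w = 0 := fun w => by
    have : φ w = 0 := LinearMap.mem_ker.1 w.2
    exact Prod.ext_iff.1 this
  have hW' : ∀ w : W, B w v = 0 ∧ B w f₀ = 0 := fun w => by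
    rw [hB _ v, hB _ f₀, (hW w).1, (hW w).2]; simp
  let B' : W →ₗ[ℝ] W →ₗ[ℝ] ℝ := B.domRestrict₁₂ W W
  have hB' : ∀ a b : W, B' a b = B a b := fun _ _ => rfl
  have hnd' : ∀ w : W, (∀ u, B' w u = 0) → w = 0 := by
    intro w hw
    refine Subtype.ext (hnd w fun u => ?_)
    -- The projection of `u` onto `W` along the plane of `v` and `f₀`; pairing with an element of
    -- `W` does not see the correction.
    have hu : u + B f₀ u • v - B v u • f₀ ∈ W := by
      simp [W, φ, hf₀, hf₀', hself]
    have := hw ⟨_, hu⟩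
    simpa [hB', (hW' w).1, (hW' w).2] using this
  by_cases htriv : ∃ w : W, w ≠ 0
  · obtain ⟨w, hw⟩ := htriv
    obtain ⟨n, e, f, hn, -, hee, hff, hef⟩ :=
      ih _ (by omega) B' (fun a b => hB a b) hnd' w hw rfl
    refine ⟨n + 1, Fin.cons v fun i => e i, Fin.cons f₀ fun i => f i, by omega, rfl, ?_, ?_, ?_⟩
    · intro i j
      refine Fin.cases ?_ (fun i => ?_) i <;> refine Fin.cases ?_ (fun j => ?_) j
      exacts [hself v, (hW _).1, (hW' _).1, hee i j]
    · intro i j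
      refine Fin.cases ?_ (fun i => ?_) i <;> refine Fin.cases ?_ (fun j => ?_) j
      exacts [hself _, (hW _).2, (hW' _).2, hff i j]
    · intro i j
      refine Fin.cases ?_ (fun i => ?_) i <;> refine Fin.cases ?_ (fun j => ?_) j
      · simpa using hf₀
      · simpa [(Fin.succ_ne_zero _).symm] using (hW (f j)).1
      · simpa using (hW' (e i)).2
      · simpa [hB'] using hef i j
  · push Not at htriv
    have : Module.finrank ℝ W = 0 := by
      have : Subsingleton W := ⟨fun a b => by rw [htriv a, htriv b]⟩
      exact Module.finrank_zero_of_subsingleton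
    refine ⟨0, fun _ => v, fun _ => f₀, by omega, rfl, fun _ _ => hself v, fun _ _ => hself _, ?_⟩
    intro i j
    simp [hf₀, Subsingleton.elim (α := Fin 1) i j]

/-! ### Positivity of the signed sum over permutations -/

/-- The standard symplectic form on basis vectors indexed by `ι × Bool`. -/
def stdSymplectic {ι : Type*} [DecidableEq ι] (a b : ι × Bool) : ℝ :=
  if a.1 = b.1 then (if a.2 = b.2 then 0 else if a.2 then -1 else 1) else 0

/-- A nonzero product forces `σ` to map pairs to pairs: it permutes the pairs by `τ` and flips some
of them by `ε`. Moving whole pairs is even, and each flip changes both the sign of `σ` and the sign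
of one factor. -/
theorem sign_mul_prod_stdSymplectic {ι : Type*} [Fintype ι] [DecidableEq ι]
    (σ : Equiv.Perm (ι × Bool))
    (h : ∏ i, stdSymplectic (σ (i, false)) (σ (i, true)) ≠ 0) :
    ((Equiv.Perm.sign σ : ℤ) : ℝ) * ∏ i, stdSymplectic (σ (i, false)) (σ (i, true)) = 1 := by
  have hne : ∀ i, stdSymplectic (σ (i, false)) (σ (i, true)) ≠ 0 := fun i =>
    Finset.prod_ne_zero_iff.1 h i (Finset.mem_univ i)
  have h1 : ∀ i, (σ (i, false)).1 = (σ (i, true)).1 := fun i => by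
    by_contra h
    exact hne i (by simp [stdSymplectic, h])
  have h2 : ∀ i, (σ (i, true)).2 = !(σ (i, false)).2 := fun i => by
    have : (σ (i, false)).2 ≠ (σ (i, true)).2 := fun h => hne i (by simp [stdSymplectic, h])
    revert this
    cases (σ (i, false)).2 <;> cases (σ (i, true)).2 <;> simp
  let t : ι → ι := fun i => (σ (i, false)).1
  have ht : Function.Surjective t := fun j => by
    obtain ⟨⟨i, b⟩, hi⟩ := σ.surjective (j, false)
    refine ⟨i, ?_⟩
    cases b
    · simp [t, hi]
    · simp [t, h1, hi]
  let τ : Equiv.Perm ι := Equiv.ofBijective t ⟨Finite.injective_iff_surjective.2 ht, ht⟩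
  let ε : ι → Equiv.Perm Bool := fun i => if (σ (i, false)).2 then Equiv.swap false true else 1
  have hσ : σ = Equiv.prodCongrLeft (fun _ : Bool => τ) * Equiv.prodCongrRight ε := by
    ext1 ⟨i, b⟩
    have hτ : τ i = (σ (i, false)).1 := rfl
    refine Prod.ext ?_ ?_
    · cases b <;> simp [hτ, h1]
    · cases b
      · by_cases hc : (σ (i, false)).2 <;> simp [ε, hc]
      · by_cases hc : (σ (i, false)).2 <;> simp [ε, hc, h2]
  have hs : Equiv.Perm.sign σ = ∏ i, Equiv.Perm.sign (ε i) := by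
    conv_lhs => rw [hσ]
    rw [Equiv.Perm.sign_mul, Equiv.Perm.sign_prodCongrLeft, Equiv.Perm.sign_prodCongrRight]
    simp
  rw [hs]
  push_cast
  rw [← Finset.prod_mul_distrib]
  refine Finset.prod_eq_one fun i _ => ?_
  by_cases hc : (σ (i, false)).2 <;> simp [ε, stdSymplectic, h1, h2, hc]

theorem sum_sign_mul_stdSymplectic_pos {ι : Type*} [Fintype ι] [DecidableEq ι]
    (β : Option (ι × Bool) → ℝ) (hβ : ∀ a, β (some a) = 0) (hβ' : β none = 1)
    (Ω : Option (ι × Bool) → Option (ι × Bool) → ℝ)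
    (hΩ : ∀ a b, Ω (some a) (some b) = stdSymplectic a b) :
    0 < ∑ σ : Equiv.Perm (Option (ι × Bool)), ((Equiv.Perm.sign σ : ℤ) : ℝ) *
      (β (σ none) * ∏ i, Ω (σ (some (i, false))) (σ (some (i, true)))) := by
  have key : ∀ τ : Equiv.Perm (ι × Bool), ((Equiv.Perm.sign τ.optionCongr : ℤ) : ℝ) *
      (β (τ.optionCongr none) *
        ∏ i, Ω (τ.optionCongr (some (i, false))) (τ.optionCongr (some (i, true)))) =
      ((Equiv.Perm.sign τ : ℤ) : ℝ) * ∏ i, stdSymplectic (τ (i, false)) (τ (i, true)) := by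
    intro τ
    simp [hβ', hΩ, Equiv.optionCongr_sign]
  refine Finset.sum_pos' (fun σ _ => ?_) ⟨1, Finset.mem_univ _, ?_⟩
  -- Only permutations fixing `none` survive, because `β` vanishes on every `some a`; these come
  -- from permutations of the pairs' indices.
  · cases hσ : σ none with
    | some a => simp [hβ]
    | none =>
      obtain ⟨τ, rfl⟩ : ∃ τ : Equiv.Perm (ι × Bool), τ.optionCongr = σ := by
        refine ⟨Equiv.removeNone σ, ?_⟩
        ext1 x
        cases x with
        | none => simp [hσ]
        | some x =>
          simp only [Equiv.optionCongr_apply, Option.map_some]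
          refine Equiv.removeNone_some σ ?_
          obtain ⟨y, hy⟩ := Option.ne_none_iff_exists'.1
            (fun h : σ (some x) = none => by
              have := σ.injective (h.trans hσ.symm); simp at this)
          exact ⟨y, hy⟩
      rw [← hσ, key]
      by_cases h : ∏ i, stdSymplectic (τ (i, false)) (τ (i, true)) = 0
      · simp [h]
      · rw [sign_mul_prod_stdSymplectic τ h]; exact zero_le_one
  · simp [hβ', hΩ, stdSymplectic]

/-- The splitting of `2n+1` indices into a first one and `n` consecutive pairs. -/
noncomputable def optionPairEquiv (n : ℕ) : Option (Fin n × Bool) ≃ Fin (2 * n + 1) :=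
  Equiv.ofBijective
    (fun a => match a with
      | none => 0
      | some (i, false) => ⟨2 * i + 1, by omega⟩
      | some (i, true) => ⟨2 * i + 2, by omega⟩) <| by
    rw [Fintype.bijective_iff_injective_and_card]
    refine ⟨?_, by simp; ring⟩
    rintro (_ | ⟨i, _ | _⟩) (_ | ⟨j, _ | _⟩) h <;> simp [Fin.ext_iff] at h ⊢ <;> omega

theorem sum_sign_mul_pairs_pos {n : ℕ} (β : Option (Fin n × Bool) → ℝ)
    (hβ : ∀ a, β (some a) = 0) (hβ' : β none = 1)
    (Ω : Option (Fin n × Bool) → Option (Fin n × Bool) → ℝ)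
    (hΩ : ∀ a b, Ω (some a) (some b) = stdSymplectic a b) :
    0 < ∑ σ : Equiv.Perm (Fin (2 * n + 1)), ((Equiv.Perm.sign σ : ℤ) : ℝ) *
      (β ((optionPairEquiv n).symm (σ 0)) *
        ∏ i : Fin n, Ω ((optionPairEquiv n).symm (σ ⟨2 * i + 1, by omega⟩))
          ((optionPairEquiv n).symm (σ ⟨2 * i + 2, by omega⟩))) := by
  rw [← (optionPairEquiv n).permCongr.sum_comp]
  have h0 : (optionPairEquiv n).symm 0 = none := by rw [Equiv.symm_apply_eq]; rfl
  have h1 : ∀ i : Fin n, (optionPairEquiv n).symm ⟨2 * i + 1, by omega⟩ = some (i, false) :=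
    fun i => by rw [Equiv.symm_apply_eq]; rfl
  have h2 : ∀ i : Fin n, (optionPairEquiv n).symm ⟨2 * i + 2, by omega⟩ = some (i, true) :=
    fun i => by rw [Equiv.symm_apply_eq]; rfl
  simpa only [Equiv.Perm.sign_permCongr, Equiv.permCongr_apply, Equiv.symm_apply_apply, h0, h1, h2]
    using sum_sign_mul_stdSymplectic_pos β hβ hβ' Ω hΩ

/-! ### Parametric integrals and Hadamard's lemma -/

open MeasureTheory in
theorem contDiff_integral_unitInterval {E F : Type*} [NormedAddCommGroup E] [NormedSpace ℝ E]
    [NormedAddCommGroup F] [NormedSpace ℝ F] (G : E × ℝ → F) (hG : ContDiff ℝ ∞ G) :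
    ContDiff ℝ ∞ fun y => ∫ t in (0 : ℝ)..1, G (y, t) := by
  let ρ : ContDiffBump (0 : ℝ) := ⟨1, 2, one_pos, one_lt_two⟩
  -- The integral is the convolution at 0 of the indicator of (0, 1] with `g y`. The cutoff supplies
  -- the uniform compact support and equals 1 wherever the indicator is nonzero.
  let g : E → ℝ → F := fun y t => ρ t • G (y, -t)
  have hg : ContDiff ℝ ∞ ↿g :=
    (ρ.contDiff.comp contDiff_snd).smul (hG.comp (contDiff_fst.prodMk contDiff_snd.neg))
  have hf : LocallyIntegrable (Set.indicator (Set.Ioc (0 : ℝ) 1) fun _ => (1 : ℝ)) :=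
    ((integrable_indicator_iff measurableSet_Ioc).2 (by simp)).locallyIntegrable
  have key := contDiffOn_convolution_right_with_param_comp (ContinuousLinearMap.lsmul ℝ ℝ)
    (v := fun _ : E => (0 : ℝ)) (n := ⊤) contDiffOn_const (g := g) isOpen_univ
    (isCompact_closedBall (0 : ℝ) 2)
    (fun p x _ hx => by
      have : ρ x = 0 := ρ.zero_of_le_dist (not_le.1 hx).le
      simp [g, this]) hf (μ := volume) hg.contDiffOn
  rw [contDiffOn_univ] at key
  convert key using 2 with y
  rw [convolution_def, intervalIntegral.integral_of_le zero_le_one,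
    ← integral_indicator measurableSet_Ioc]
  congr 1 with t
  by_cases ht : t ∈ Set.Ioc (0 : ℝ) 1
  · have : ρ (-t) = 1 := ρ.one_of_mem_closedBall (by
      simp only [Metric.mem_closedBall, dist_zero_right, norm_neg, Real.norm_eq_abs]
      exact abs_le.2 ⟨by linarith [ht.1], ht.2⟩)
    simp [ht, g, this]
  · simp [ht]

/-- **Hadamard's lemma**. -/
theorem exists_contDiff_eq_add_apply_sub {E : Type*} [NormedAddCommGroup E] [NormedSpace ℝ E]
    (F : E → ℝ) (hF : ContDiff ℝ ∞ F) (q : E) :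
    ∃ H : E → E →L[ℝ] ℝ, ContDiff ℝ ∞ H ∧ ∀ y, F y = F q + H y (y - q) := by
  have hF' : ContDiff ℝ ∞ (fderiv ℝ F) := hF.fderiv_right (by simp)
  have hG : ContDiff ℝ ∞ fun x : E × ℝ => fderiv ℝ F (q + x.2 • (x.1 - q)) :=
    hF'.comp (contDiff_const.add (contDiff_snd.smul (contDiff_fst.sub contDiff_const)))
  -- H is the average of the derivative of `F` along the segment from `q` to `y`.
  refine ⟨_, contDiff_integral_unitInterval _ hG, fun y => ?_⟩
  have hcont : Continuous fun t : ℝ => fderiv ℝ F (q + t • (y - q)) :=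
    hF'.continuous.comp (by fun_prop)
  dsimp only
  rw [ContinuousLinearMap.intervalIntegral_apply (hcont.intervalIntegrable _ _)]
  have hd : ∀ t ∈ Set.uIcc (0 : ℝ) 1, HasDerivAt (fun t : ℝ => F (q + t • (y - q)))
      (fderiv ℝ F (q + t • (y - q)) (y - q)) t := fun t _ => by
    have h1 : HasDerivAt (fun t : ℝ => q + t • (y - q)) (y - q) t := by
      simpa using ((hasDerivAt_id t).smul_const (y - q)).const_add q
    exact ((hF.differentiable (by simp)) _).hasFDerivAt.comp_hasDerivAt t h1
  rw [intervalIntegral.integral_eq_sub_of_hasDerivAt hd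
    ((hcont.clm_apply continuous_const).intervalIntegrable _ _)]
  simp

/-! ### Chart derivations and local frames -/

section Manifold

variable {m : ℕ} {M : Type*} [TopologicalSpace M]
    [ChartedSpace (EuclideanSpace ℝ (Fin m)) M] [IsManifold (𝓡 m) ∞ M]

/-- The expression in a chart of a smooth function. -/
theorem contDiffOn_comp_extChartAt_symm (p : M) (h : SmoothFn m M) :
    ContDiffOn ℝ ∞ (h ∘ (extChartAt (𝓡 m) p).symm) (extChartAt (𝓡 m) p).target :=
  contMDiffOn_iff_contDiffOn.1 (h.contMDiff.comp_contMDiffOn (contMDiffOn_extChartAt_symm p))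

/-- The product of a bump function and of a smooth function on the chart. -/
noncomputable def SmoothBumpFunction.mulChart [T2Space M] {p : M} (b : SmoothBumpFunction (𝓡 m) p)
    (k : EuclideanSpace ℝ (Fin m) → ℝ) (hk : ContDiffOn ℝ ∞ k (extChartAt (𝓡 m) p).target) :
    SmoothFn m M :=
  ⟨fun z => b z • k (extChartAt (𝓡 m) p z), b.contMDiff_smul
    (hk.contMDiffOn.comp contMDiffOn_extChartAt fun z hz =>
      (extChartAt (𝓡 m) p).map_source (by rwa [extChartAt_source]))⟩

theorem SmoothBumpFunction.mulChart_apply [T2Space M] {p : M} (b : SmoothBumpFunction (𝓡 m) p)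
    (k : EuclideanSpace ℝ (Fin m) → ℝ) (hk : ContDiffOn ℝ ∞ k (extChartAt (𝓡 m) p).target)
    (z : M) : b.mulChart k hk z = b z * k (extChartAt (𝓡 m) p z) := rfl

theorem contDiffOn_fderiv_chart (p : M) (h : SmoothFn m M) (v : EuclideanSpace ℝ (Fin m)) :
    ContDiffOn ℝ ∞ (fun y => fderiv ℝ (h ∘ (extChartAt (𝓡 m) p).symm) y v)
      (extChartAt (𝓡 m) p).target :=
  ((contDiffOn_comp_extChartAt_symm p h).fderiv_of_isOpen (isOpen_extChartAt_target p)
    (by simp)).clm_apply contDiffOn_const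

theorem differentiableAt_comp_extChartAt_symm (p : M) (h : SmoothFn m M)
    {y : EuclideanSpace ℝ (Fin m)} (hy : y ∈ (extChartAt (𝓡 m) p).target) :
    DifferentiableAt ℝ (h ∘ (extChartAt (𝓡 m) p).symm) y :=
  ((contDiffOn_comp_extChartAt_symm p h).differentiableOn (by simp)).differentiableAt
    ((isOpen_extChartAt_target p).mem_nhds hy)

/-- The derivation `b ∂_v`, for a constant vector `v` in a chart and a bump function `b`. -/
noncomputable def SmoothBumpFunction.chartDerivation [T2Space M] {p : M}
    (b : SmoothBumpFunction (𝓡 m) p)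
    (v : EuclideanSpace ℝ (Fin m)) : VecField m M :=
  Derivation.mk'
    { toFun := fun h => b.mulChart _ (contDiffOn_fderiv_chart p h v)
      map_add' := fun h k => by
        ext z
        -- Outside the chart domain the bump function vanishes, so the values of `fderiv` there are
        -- irrelevant.
        by_cases hz : z ∈ (chartAt (EuclideanSpace ℝ (Fin m)) p).source
        · have hz' : z ∈ (extChartAt (𝓡 m) p).source := by rwa [extChartAt_source]
          have ht := (extChartAt (𝓡 m) p).map_source hz'
          have := fderiv_add (differentiableAt_comp_extChartAt_symm p h ht)
            (differentiableAt_comp_extChartAt_symm p k ht)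
          simp only [ContMDiffMap.coe_add, Pi.add_apply, mulChart_apply, ← mul_add]
          rw [← add_apply, ← this]
          rfl
        · have : b z = 0 := Function.notMem_support.1 fun h => hz (b.support_subset_source h)
          simp [mulChart_apply, this]
      map_smul' := fun c h => by
        ext z
        by_cases hz : z ∈ (chartAt (EuclideanSpace ℝ (Fin m)) p).source
        · have hz' : z ∈ (extChartAt (𝓡 m) p).source := by rwa [extChartAt_source]
          have ht := (extChartAt (𝓡 m) p).map_source hz'
          have := fderiv_const_smul (differentiableAt_comp_extChartAt_symm p h ht) c
          simp only [ContMDiffMap.coe_smul, Pi.smul_apply, mulChart_apply, RingHom.id_apply,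
            smul_eq_mul]
          rw [mul_left_comm, ← smul_eq_mul c, ← smul_apply, ← this]
          rfl
        · have : b z = 0 := Function.notMem_support.1 fun h => hz (b.support_subset_source h)
          simp [mulChart_apply, this] }
    fun h k => by
      ext z
      by_cases hz : z ∈ (chartAt (EuclideanSpace ℝ (Fin m)) p).source
      · have hz' : z ∈ (extChartAt (𝓡 m) p).source := by rwa [extChartAt_source]
        have ht := (extChartAt (𝓡 m) p).map_source hz'
        have := fderiv_mul (differentiableAt_comp_extChartAt_symm p h ht)
          (differentiableAt_comp_extChartAt_symm p k ht)
        have h2 : ((h * k : SmoothFn m M) : M → ℝ) ∘ (extChartAt (𝓡 m) p).symm =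
          (h ∘ (extChartAt (𝓡 m) p).symm) * (k ∘ (extChartAt (𝓡 m) p).symm) := rfl
        simp only [LinearMap.coe_mk, AddHom.coe_mk, smul_eq_mul, ContMDiffMap.coe_add,
          ContMDiffMap.coe_mul, Pi.add_apply, Pi.mul_apply, mulChart_apply]
        rw [← ContMDiffMap.coe_mul, h2, this]
        simp only [add_apply, smul_apply, smul_eq_mul, Function.comp_apply,
          (extChartAt (𝓡 m) p).left_inv hz']
        ring
      · have : b z = 0 := Function.notMem_support.1 fun h => hz (b.support_subset_source h)
        simp [mulChart_apply, this]

theorem SmoothBumpFunction.chartDerivation_apply [T2Space M] {p : M}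
    (b : SmoothBumpFunction (𝓡 m) p)
    (v : EuclideanSpace ℝ (Fin m)) (h : SmoothFn m M) (z : M) :
    b.chartDerivation v h z =
      b z * fderiv ℝ (h ∘ (extChartAt (𝓡 m) p).symm) (extChartAt (𝓡 m) p z) v := rfl

/-- Derivations are local. -/
theorem Derivation.apply_eq_of_eventuallyEq [T2Space M] (Y : VecField m M)
    {h k : SmoothFn m M} {q : M}
    (hk : h =ᶠ[nhds q] k) : Y h q = Y k q := by
  rw [← sub_eq_zero]
  obtain ⟨b, hb, -⟩ := (SmoothBumpFunction.nhds_basis_support (I := 𝓡 m) hk).mem_iff.1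
    (Filter.univ_mem (f := nhds q))
  obtain ⟨B, hBb⟩ : ∃ B : SmoothFn m M, ∀ z, B z = b z := ⟨⟨b, b.contMDiff⟩, fun _ => rfl⟩
  have hB : B q = 1 := (hBb q).trans b.eq_one
  -- `B` is supported where `h = k`; the Leibniz rule for this zero product, evaluated at `q`, gives
  -- the claim.
  have h0 : B * (h - k) = 0 := by
    ext z
    by_cases hz : z ∈ tsupport b
    · have : h z = k z := hb hz
      simp [this]
    · have : b z = 0 := image_eq_zero_of_notMem_tsupport hz
      simp [hBb, this]
  have h1 : (B * Y (h - k) + (h - k) * Y B) q = 0 := by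
    rw [← smul_eq_mul, ← smul_eq_mul, ← Y.leibniz, h0, map_zero]; rfl
  have h2 : h q = k q := hk.eq_of_nhds
  simpa [hB, h2] using h1

/-- Bump functions globalise the coordinates and coordinate fields; multiplying by `g` replaces
restriction to a neighbourhood of `p`. The fields span because a derivation is determined on the
coordinates, by locality and Hadamard's lemma. -/
theorem exists_local_frame [T2Space M] (p : M) :
    ∃ (x : Fin m → SmoothFn m M) (X : Fin m → VecField m M) (g : SmoothFn m M), g p = 1 ∧
      (∀ i j, g * X i (x j) = if i = j then g else 0) ∧
      ∀ Y : VecField m M, g • Y = g • ∑ i, Y (x i) • X i := by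
  obtain ⟨b⟩ : Nonempty (SmoothBumpFunction (𝓡 m) p) := inferInstance
  -- The outer radius of `g'` is the inner radius of `b`, so `b = 1` wherever `g'` is nonzero.
  let g' : SmoothBumpFunction (𝓡 m) p :=
    ⟨⟨b.rIn / 2, b.rIn, half_pos b.rIn_pos, half_lt_self b.rIn_pos⟩,
      (Set.inter_subset_inter_left _ (Metric.closedBall_subset_closedBall b.rIn_lt_rOut.le)).trans
        b.closedBall_subset⟩
  let φ := extChartAt (𝓡 m) p
  let e : Fin m → EuclideanSpace ℝ (Fin m) := fun i => EuclideanSpace.single i 1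
  have hc : ∀ i, ContDiff ℝ ∞ fun y : EuclideanSpace ℝ (Fin m) => y i := fun i => by fun_prop
  let x : Fin m → SmoothFn m M := fun i => b.mulChart _ (hc i).contDiffOn
  let X : Fin m → VecField m M := fun i => b.chartDerivation (e i)
  let U : Set M := φ.source ∩ φ ⁻¹' Metric.ball (φ p) b.rIn
  have hU : IsOpen U := by
    have := isOpen_extChartAt_preimage (I := 𝓡 m) p (Metric.isOpen_ball (x := φ p) (ε := b.rIn))
    simpa only [U, φ, extChartAt_source] using this
  have hbU : ∀ z ∈ U, b z = 1 := fun z hz =>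
    b.one_of_dist_le (by simpa only [φ, extChartAt_source] using hz.1) (le_of_lt hz.2)
  have hgU : ∀ z, g' z ≠ 0 → z ∈ U := fun z hz => by
    have : z ∈ Function.support g' := hz
    rw [g'.support_eq_inter_preimage] at this
    simpa only [U, φ, extChartAt_source] using this
  have hxU : ∀ i, ∀ z ∈ U, x i z = φ z i := fun i z hz => by
    simp [x, SmoothBumpFunction.mulChart_apply, hbU z hz, φ]
  have hXx : ∀ z ∈ U, ∀ i j, X i (x j) z = if i = j then 1 else 0 := by
    intro z hz i j
    have : (x j ∘ φ.symm) =ᶠ[nhds (φ z)] fun y => y j := by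
      have hn : φ.target ∩ Metric.ball (φ p) b.rIn ∈ nhds (φ z) :=
        ((isOpen_extChartAt_target p).inter Metric.isOpen_ball).mem_nhds
          ⟨φ.map_source hz.1, hz.2⟩
      filter_upwards [hn] with y hy
      have : φ.symm y ∈ U := ⟨φ.map_target hy.1, by simpa [φ.right_inv hy.1] using hy.2⟩
      rw [Function.comp_apply, hxU _ _ this, φ.right_inv hy.1]
    have h3 : HasFDerivAt (fun y : EuclideanSpace ℝ (Fin m) => y j)
      (EuclideanSpace.proj j : EuclideanSpace ℝ (Fin m) →L[ℝ] ℝ) (φ z) :=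
      (EuclideanSpace.proj j : EuclideanSpace ℝ (Fin m) →L[ℝ] ℝ).hasFDerivAt
    rw [SmoothBumpFunction.chartDerivation_apply, hbU z hz, this.fderiv_eq, h3.fderiv]
    simp [e, eq_comm]
  have hsum : ∀ (f : Fin m → SmoothFn m M) (z : M), (∑ i, f i) z = ∑ i, f i z := fun f z =>
    map_sum (ContMDiffMap.evalRingHom z : SmoothFn m M →+* ℝ) f Finset.univ
  have halg : ∀ (c : ℝ) (z : M), algebraMap ℝ (SmoothFn m M) c z = c := fun _ _ => rfl
  have hadamard : ∀ (h : SmoothFn m M), ∀ q ∈ U, ∃ k : Fin m → SmoothFn m M,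
      ∀ Y : VecField m M, Y h q = ∑ i, Y (x i) q * k i q := by
    intro h q hq
    -- The cutoff makes the chart expression smooth on all of Euclidean space, as Hadamard's lemma
    -- requires.
    have hF : ContDiff ℝ ∞ fun y => b.toContDiffBump y * (h ∘ φ.symm) y := by
      refine contMDiff_iff_contDiff.1 (contMDiff_of_tsupport fun y hy => ?_)
      refine ContDiffAt.contMDiffAt ?_
      have hy1 := tsupport_mul_subset_left hy
      rw [b.tsupport_eq] at hy1
      have hy2 : y ∈ φ.target := b.closedBall_subset ⟨hy1, by simp⟩
      exact b.contDiffAt.mul ((contDiffOn_comp_extChartAt_symm p h).contDiffAt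
        ((isOpen_extChartAt_target p).mem_nhds hy2))
    obtain ⟨H, hH, hHF⟩ := exists_contDiff_eq_add_apply_sub _ hF (φ q)
    have hk : ∀ i, ContDiff ℝ ∞ fun y => H y (e i) := fun i => hH.clm_apply contDiff_const
    refine ⟨fun i => b.mulChart _ (hk i).contDiffOn, fun Y => ?_⟩
    have heq : h =ᶠ[nhds q] (algebraMap ℝ (SmoothFn m M) (h q) + ∑ i,
        (x i - algebraMap ℝ (SmoothFn m M) (x i q)) * b.mulChart _ (hk i).contDiffOn :
          SmoothFn m M) := by
      filter_upwards [hU.mem_nhds hq] with z hz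
      have hFU : ∀ w ∈ U, b.toContDiffBump (φ w) * (h ∘ φ.symm) (φ w) = h w := fun w hw => by
        rw [b.one_of_mem_closedBall (Metric.ball_subset_closedBall hw.2), one_mul,
          Function.comp_apply, φ.left_inv hw.1]
      have h1 := hHF (φ z)
      rw [hFU z hz, hFU q hq] at h1
      have h2 : φ z - φ q = ∑ i, (φ z i - φ q i) • e i := by
        have := (EuclideanSpace.basisFun (Fin m) ℝ).sum_repr (φ z - φ q)
        simpa [e] using this.symm
      rw [h2, map_sum] at h1
      rw [h1]
      simp [hsum, halg, SmoothBumpFunction.mulChart_apply, hbU z hz, hxU _ z hz, hxU _ q hq, φ]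
    rw [Y.apply_eq_of_eventuallyEq heq]
    simp [hsum, halg, Derivation.leibniz, mul_comm]
  obtain ⟨g, hg⟩ : ∃ g : SmoothFn m M, ∀ z, g z = g' z := ⟨⟨g', g'.contMDiff⟩, fun _ => rfl⟩
  refine ⟨x, X, g, (hg p).trans g'.eq_one, fun i j => ?_, fun Y => ?_⟩
  · ext z
    by_cases hz : g' z = 0
    · split_ifs <;> simp [hg, hz]
    · have := hXx z (hgU z hz) i j
      rw [ContMDiffMap.coe_mul, Pi.mul_apply, this]
      split_ifs <;> simp
  · ext h z
    by_cases hz : g' z = 0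
    · simp [hg, hz]
    · have hzU := hgU z hz
      obtain ⟨k, hk⟩ := hadamard h z hzU
      have hY : (∑ i, Y (x i) • X i) h = ∑ i, Y (x i) * X i h := by
        rw [← Derivation.coeFnAddMonoidHom_apply]
        simp [map_sum]
      simp only [Derivation.smul_apply, hY, smul_eq_mul, ContMDiffMap.coe_mul, Pi.mul_apply, hsum,
        hk, hXx z hzU]
      simp

end Manifold

/-! ### Operators of order at most one as functions plus derivations -/

namespace DiffOp

variable {K A : Type*} [Field K] [CommRing A] [Algebra K A]

theorem ext {P Q : DiffOp K A} (h : ∀ a, P.1 a = Q.1 a) : P = Q :=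
  Subtype.ext (LinearMap.ext h)

theorem smul_val_apply (c : A) (P : DiffOp K A) (a : A) : (c • P).1 a = c * P.1 a := rfl

theorem apply_mul (P : DiffOp K A) (a b : A) :
    P.1 (a * b) = a * P.1 b + b * P.1 a - a * b * P.1 1 := by
  have h := LinearMap.congr_fun (P.2 a b) 1
  simp only [Ring.lie_def, LinearMap.sub_apply, Module.End.mul_apply, LinearMap.mulLeft_apply,
    mul_one, LinearMap.zero_apply] at h
  linear_combination h

/-- The identity, as a differential operator. -/
def id : DiffOp K A :=
  ⟨1, fun a b => by
    ext c
    simp [Ring.lie_def]⟩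

theorem id_val_apply (a : A) : (id : DiffOp K A).1 a = a := rfl

/-- Derivations are differential operators of order `≤ 1`. -/
def ofDerivation : Derivation K A A →ₗ[A] DiffOp K A where
  toFun X := ⟨X, fun a b => by
    ext c
    simp only [Ring.lie_def, LinearMap.sub_apply, Module.End.mul_apply, LinearMap.mulLeft_apply,
      Derivation.coeFn_coe, Derivation.leibniz, smul_eq_mul, LinearMap.zero_apply]
    ring⟩
  map_add' _ _ := rfl
  map_smul' _ _ := rfl

theorem ofDerivation_val_apply (X : Derivation K A A) (a : A) : (ofDerivation X).1 a = X a := rfl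

/-- The value of a differential operator at `1`. -/
def applyOne : DiffOp K A →ₗ[A] A where
  toFun P := P.1 1
  map_add' _ _ := rfl
  map_smul' _ _ := rfl

theorem applyOne_apply (P : DiffOp K A) : applyOne P = P.1 1 := rfl

/-- The derivation part `P - P(1)` of a differential operator `P`. -/
def toDerivation : DiffOp K A →ₗ[A] Derivation K A A where
  toFun P := Derivation.mk' (P.1 - LinearMap.mulLeft K (P.1 1)) fun a b => by
    simp only [LinearMap.sub_apply, LinearMap.mulLeft_apply, apply_mul, smul_eq_mul]
    ring
  map_add' P Q := by
    ext a
    simp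
    ring
  map_smul' c P := by
    ext a
    simp [smul_val_apply]
    ring

theorem toDerivation_apply (P : DiffOp K A) (a : A) : toDerivation P a = P.1 a - P.1 1 * a := rfl

theorem toDerivation_ofDerivation (X : Derivation K A A) : toDerivation (ofDerivation X) = X := by
  ext a
  simp [toDerivation_apply, ofDerivation_val_apply]

theorem toDerivation_id : toDerivation (id : DiffOp K A) = 0 := by
  ext a
  simp [toDerivation_apply, id_val_apply]

theorem eq_add_ofDerivation (P : DiffOp K A) :
    P = applyOne P • id + ofDerivation (toDerivation P) := by
  refine ext fun a => ?_
  simp [smul_val_apply, ofDerivation_val_apply, toDerivation_apply, id_val_apply,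
    applyOne_apply]

end DiffOp

/-! ### From the fibres to the manifold -/

/-- The fibrewise statement: `v` plays the identity operator and the kernel of `π` plays the
derivations. -/
theorem exists_sum_sign_mul_pairs_pos {m : ℕ} {V : Type*} [AddCommGroup V] [Module ℝ V]
    [FiniteDimensional ℝ V] (B : V →ₗ[ℝ] V →ₗ[ℝ] ℝ) (hB : ∀ v w, B v w = -B w v)
    (hnd : ∀ v, (∀ w, B v w = 0) → v = 0) (hm : Module.finrank ℝ V = m + 1)
    (v : V) (π : V →ₗ[ℝ] ℝ) (hπ : π v = 1) :
    ∃ n, m = 2 * n + 1 ∧ ∃ X : Fin (2 * n + 1) → V, (∀ i, π (X i) = 0) ∧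
      0 < ∑ σ : Equiv.Perm (Fin (2 * n + 1)), ((Equiv.Perm.sign σ : ℤ) : ℝ) *
        (B v (X (σ 0)) *
          ∏ i : Fin n, B (X (σ ⟨2 * i + 1, by omega⟩)) (X (σ ⟨2 * i + 2, by omega⟩))) := by
  have hv : v ≠ 0 := by rintro rfl; simp at hπ
  obtain ⟨n, e, f, hn, rfl, hee, hff, hef⟩ := exists_symplectic_basis B hB hnd v hv
  refine ⟨n, by omega, ?_⟩
  let Y : Option (Fin n × Bool) → V := fun a => match a with
    | none => f 0
    | some (i, false) => e i.succ
    | some (i, true) => f i.succ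
  -- Projection to the kernel of `π` along `e 0`. The needed pairings are unchanged, as `e 0` is
  -- orthogonal to itself and to every `Y (some a)`.
  let Z : Option (Fin n × Bool) → V := fun a => Y a - π (Y a) • e 0
  refine ⟨fun i => Z ((optionPairEquiv n).symm i), fun i => by simp [Z, hπ], ?_⟩
  have h0 : ∀ a, B (e 0) (Y (some a)) = 0 := by
    rintro ⟨i, _ | _⟩
    · exact hee _ _
    · simp [Y, hef, (Fin.succ_ne_zero _).symm]
  have h0' : ∀ a, B (Y (some a)) (e 0) = 0 := fun a => by rw [hB, h0, neg_zero]
  refine sum_sign_mul_pairs_pos (fun a => B (e 0) (Z a)) (fun a => ?_) ?_ (fun a b => B (Z a) (Z b))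
    fun a b => ?_
  · simp [Z, h0, hee]
  · simp [Z, Y, hee, hef]
  · have : B (Z (some a)) (Z (some b)) = B (Y (some a)) (Y (some b)) := by
      simp [Z, h0, h0', hee]
    rw [this]
    obtain ⟨i, _ | _⟩ := a <;> obtain ⟨j, _ | _⟩ := b <;>
      simp [Y, stdSymplectic, hee, hff, hef, hB (f _) (e _), eq_comm]
    split_ifs <;> simp

theorem SmoothFn.sum_apply {m : ℕ} {M : Type*} [TopologicalSpace M]
    [ChartedSpace (EuclideanSpace ℝ (Fin m)) M] {ι : Type*} (s : Finset ι) (f : ι → SmoothFn m M)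
    (p : M) : (∑ i ∈ s, f i) p = ∑ i ∈ s, f i p :=
  map_sum (ContMDiffMap.evalRingHom p : SmoothFn m M →+* ℝ) f s

theorem SmoothFn.prod_apply {m : ℕ} {M : Type*} [TopologicalSpace M]
    [ChartedSpace (EuclideanSpace ℝ (Fin m)) M] {ι : Type*} (s : Finset ι) (f : ι → SmoothFn m M)
    (p : M) : (∏ i ∈ s, f i) p = ∏ i ∈ s, f i p :=
  map_prod (ContMDiffMap.evalRingHom p : SmoothFn m M →+* ℝ) f s

theorem wedgePow_apply {m : ℕ} {M : Type*} [TopologicalSpace M]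
    [ChartedSpace (EuclideanSpace ℝ (Fin m)) M]
    (β : VecField m M →ₗ[SmoothFn m M] SmoothFn m M)
    (Ω : VecField m M →ₗ[SmoothFn m M] VecField m M →ₗ[SmoothFn m M] SmoothFn m M)
    (n : ℕ) (X : Fin (2 * n + 1) → VecField m M) (p : M) :
    wedgePow β Ω n X p = ((2 : ℝ) ^ n)⁻¹ * ∑ σ : Equiv.Perm (Fin (2 * n + 1)),
      ((Equiv.Perm.sign σ : ℤ) : ℝ) * (β (X (σ 0)) p *
        ∏ i : Fin n, Ω (X (σ ⟨2 * i + 1, by omega⟩)) (X (σ ⟨2 * i + 2, by omega⟩)) p) := by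
  have hs : ∀ (c : ℝ) (f : SmoothFn m M), (c • f) p = c * f p := fun _ _ => rfl
  rw [wedgePow, hs, SmoothFn.sum_apply]
  simp only [hs, ContMDiffMap.coe_mul, Pi.mul_apply, SmoothFn.prod_apply]

section Manifold

variable {m : ℕ} {M : Type*} [TopologicalSpace M]
    [ChartedSpace (EuclideanSpace ℝ (Fin m)) M] [IsManifold (𝓡 m) ∞ M] [T2Space M]

/-- At a point, a form on `𝒟(M)` that represents every functional is given in a local frame
by an invertible matrix. -/
theorem exists_local_frame_gram_mul_eq_one
    (μ : DiffOpManifold m M →ₗ[SmoothFn m M] DiffOpManifold m M →ₗ[SmoothFn m M] SmoothFn m M)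
    (hμ : Function.Surjective fun P => (μ P : Module.Dual (SmoothFn m M) (DiffOpManifold m M)))
    (p : M) :
    ∃ E : Option (Fin m) → DiffOpManifold m M, E none = DiffOp.id ∧
      (∀ i, ∃ X, E (some i) = DiffOp.ofDerivation X) ∧
      ∃ C : Matrix (Option (Fin m)) (Option (Fin m)) ℝ,
        C * (Matrix.of fun i j => μ (E i) (E j) p) = 1 := by
  obtain ⟨x, X, g, hg, hX, hY⟩ := exists_local_frame (m := m) p
  let E : Option (Fin m) → DiffOpManifold m M := fun a => a.elim DiffOp.id
    fun i => DiffOp.ofDerivation (X i)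
  let evx : Fin m → VecField m M →ₗ[SmoothFn m M] SmoothFn m M := fun i =>
    { toFun := fun Y => Y (x i), map_add' := fun _ _ => rfl, map_smul' := fun _ _ => rfl }
  let Λ : Option (Fin m) → DiffOpManifold m M →ₗ[SmoothFn m M] SmoothFn m M := fun a =>
    a.elim DiffOp.applyOne fun i => evx i ∘ₗ DiffOp.toDerivation
  have hΛE : ∀ a b, g * Λ a (E b) = if a = b then g else 0 := by
    rintro (_ | i) (_ | j)
    · simp [Λ, E, DiffOp.applyOne_apply, DiffOp.id_val_apply]
    · simp [Λ, E, DiffOp.applyOne_apply, DiffOp.ofDerivation_val_apply]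
    · simp [Λ, E, DiffOp.toDerivation_id]
    · simp [Λ, E, evx, DiffOp.toDerivation_ofDerivation, hX, eq_comm]
  have hdec : ∀ P, g • P = g • ∑ a, Λ a P • E a := by
    intro P
    conv_lhs => rw [DiffOp.eq_add_ofDerivation P, smul_add, ← map_smul, hY, map_smul, ← smul_add]
    rw [Fintype.sum_option, map_sum]
    simp only [map_smul]
    rfl
  -- `Q a` represents the coordinate functional `Λ a`; its own coordinates at `p` form row `a` of
  -- the inverse Gram matrix.
  choose Q hQ using fun a => hμ (Λ a)
  refine ⟨E, rfl, fun i => ⟨X i, rfl⟩, Matrix.of fun a c => Λ c (Q a) p, ?_⟩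
  ext a b
  have h1 : (if a = b then g else 0) = g * ∑ c, Λ c (Q a) * μ (E c) (E b) := by
    rw [← hΛE a b, ← hQ a]
    have := congrArg (fun P => μ P (E b)) (hdec (Q a))
    simpa [mul_add] using this
  have h2 := congrArg (fun f : SmoothFn m M => f p) h1
  simp only [ContMDiffMap.coe_mul, Pi.mul_apply, hg, one_mul, SmoothFn.sum_apply] at h2
  rw [Matrix.mul_apply, Matrix.one_apply]
  simp only [Matrix.of_apply]
  rw [← h2]
  split_ifs
  · exact hg
  · rfl

end Manifold

theorem corollary13 (m : ℕ) (M : Type*) [TopologicalSpace M]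
    [ChartedSpace (EuclideanSpace ℝ (Fin m)) M] [IsManifold (𝓡 m) ∞ M]
    [T2Space M] [ParacompactSpace M] [ConnectedSpace M]
    (h : Nonempty (SymplecticLieRinehartJacobi ℝ (SmoothFn m M) (DiffOpManifold m M))) :
    IsNonexactContactManifold m M := by
  obtain ⟨S⟩ := h
  let ι : VecField m M →ₗ[SmoothFn m M] DiffOpManifold m M := DiffOp.ofDerivation
  have key : ∀ p : M, ∃ n, m = 2 * n + 1 ∧ ∃ X : Fin (2 * n + 1) → VecField m M,
      wedgePow (S.μ DiffOp.id ∘ₗ ι) (S.μ.compl₁₂ ι ι) n X p ≠ 0 := by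
    intro p
    obtain ⟨E, hE₀, hE, C, hC⟩ := exists_local_frame_gram_mul_eq_one S.μ S.nondegenerate.2 p
    choose Y hY using hE
    set G : Matrix (Option (Fin m)) (Option (Fin m)) ℝ := Matrix.of fun i j => S.μ (E i) (E j) p
      with hG
    have hGt : ∀ i j, G i j = -G j i := fun i j => by
      simp only [hG, Matrix.of_apply]
      rw [S.skew]; rfl
    have hBG : ∀ v w, Matrix.toBilin' G v w = ∑ i, ∑ j, v i * G i j * w j :=
      fun v w => Matrix.toBilin'_apply G v w
    obtain ⟨n, hn, c, hc, hpos⟩ := exists_sum_sign_mul_pairs_pos (m := m) (Matrix.toBilin' G)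
      (fun v w => by
        rw [hBG, hBG, Finset.sum_comm, ← Finset.sum_neg_distrib]
        refine Finset.sum_congr rfl fun i _ => ?_
        rw [← Finset.sum_neg_distrib]
        refine Finset.sum_congr rfl fun j _ => ?_
        rw [hGt]; ring)
      (fun v hv => by
        have h1 : Matrix.vecMul v G = 0 := by
          ext j
          have := hv (Pi.single j 1)
          rw [hBG] at this
          simpa [Matrix.vecMul, dotProduct, Pi.single_apply] using this
        have h2 : G * C = 1 := mul_eq_one_comm.1 hC
        rw [← Matrix.vecMul_one v, ← h2, ← Matrix.vecMul_vecMul, h1, Matrix.zero_vecMul])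
      (by simp) (Pi.single none 1) (LinearMap.proj none) (by simp)
    -- The `none` coordinate of `c k` is zero, so these vector fields realise `c k` exactly in the
    -- fibre at `p`.
    refine ⟨n, hn, fun k => ∑ i, c k (some i) • Y i, ?_⟩
    have hιX : ∀ k, ι (∑ i, c k (some i) • Y i) =
        ∑ a, algebraMap ℝ (SmoothFn m M) (c k a) • E a := by
      intro k
      have : c k none = 0 := hc k
      rw [Fintype.sum_option, this, map_zero, zero_smul, zero_add, map_sum]
      refine Finset.sum_congr rfl fun i _ => ?_
      rw [hY, ← algebraMap_smul (SmoothFn m M) (c k (some i)) (Y i), map_smul]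
    have halg : ∀ c : ℝ, algebraMap ℝ (SmoothFn m M) c p = c := fun _ => rfl
    have hΩ : ∀ k l, S.μ (ι (∑ i, c k (some i) • Y i)) (ι (∑ i, c l (some i) • Y i)) p =
        Matrix.toBilin' G (c k) (c l) := by
      intro k l
      rw [hιX, hιX, hBG]
      simp only [map_sum, map_smul, LinearMap.sum_apply, LinearMap.smul_apply, smul_eq_mul,
        Finset.mul_sum, SmoothFn.sum_apply, ContMDiffMap.coe_mul, Pi.mul_apply, halg]
      rw [Finset.sum_comm]
      refine Finset.sum_congr rfl fun i _ => Finset.sum_congr rfl fun j _ => ?_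
      simp only [hG, Matrix.of_apply]
      ring
    have hβ : ∀ k, S.μ DiffOp.id (ι (∑ i, c k (some i) • Y i)) p =
        Matrix.toBilin' G (Pi.single none 1) (c k) := by
      intro k
      rw [hBG, Fintype.sum_eq_single none (fun i hi => by simp [hi]), hιX, ← hE₀]
      simp only [map_sum, map_smul, smul_eq_mul, SmoothFn.sum_apply, ContMDiffMap.coe_mul,
        Pi.mul_apply, halg, Pi.single_eq_same, one_mul]
      refine Finset.sum_congr rfl fun j _ => ?_
      simp only [hG, Matrix.of_apply]
      ring
    rw [wedgePow_apply]
    refine mul_ne_zero (by positivity) ?_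
    simp only [LinearMap.comp_apply, LinearMap.compl₁₂_apply, hΩ, hβ]
    exact hpos.ne'
  -- A point is needed to fix `n`; the values found at other points agree since m = 2n + 1.
  obtain ⟨p₀⟩ : Nonempty M := inferInstance
  obtain ⟨n, hn, -⟩ := key p₀
  refine ⟨n, hn, S.μ DiffOp.id ∘ₗ ι, S.μ.compl₁₂ ι ι, fun X Y => S.skew _ _, fun p => ?_⟩
  obtain ⟨n', hn', hX⟩ := key p
  obtain rfl : n' = n := by omega
  exact hX
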